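/- **Theorem.** Listing all induced diamonds (the diamond is $K_4$ minus an edge) requires $\Omega(\sqrt n/\log n)$ rounds in the $\mathsf{CONGEST}$ model, even for randomized algorithms. In this model the network is the input graph $G$, a simple undirected graph on $n$ nodes. Each node initially knows $n$, its own unique identifier (a bit string of some fixed length $\ell$, $2^\ell\ge n$), the identifiers of its neighbours, and a private sequence of independent fair coin flips. Computation proceeds in synchronous rounds. In each round every node performs unlimited local computation and sends to each of its neighbours a (possibly different) message of at most $B=O(\log n)$ bits. After the last round every node outputs a list of sets of nodes. The algorithm lists all induced diamonds of $G$ if every vertex set that induces a diamond in $G$ is output by at least one node, and every set that is output by some node induces a diamond in $G$. Precisely: for all constants $\beta>0$ and $p>0$ there are $c>0$ and $N$, depending only on $\beta$ and $p$, such that for every $n\ge N$, every $\ell$ with $2^\ell\ge n$ and every $B\le\beta\log n$, each $T$-round algorithm that, on every $n$-node graph and for every assignment of distinct $\ell$-bit identifiers, lists all induced diamonds with probability at least $p$ satisfies $T\ge c\sqrt n/\log n$. -/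

import Mathlib

open MeasureTheory

/-- Identifiers: bit strings of length `ℓ`. -/
abbrev NodeId (ℓ : ℕ) : Type := Fin ℓ → Bool

/-- Messages: bit strings of length at most `B` (the empty string is silence). -/
abbrev Message (B : ℕ) : Type := {m : List Bool // m.length ≤ B}

/-- The private randomness of one node: an infinite sequence of coin flips. -/
abbrev Coins : Type := ℕ → Bool

/-- The law of an infinite sequence of independent fair coin flips. -/
noncomputable def coinLaw : Measure Coins :=
  Measure.infinitePi fun _ : ℕ => (PMF.uniformOfFintype Bool).toMeasure

/-- A randomized algorithm in the CONGEST model, with identifiers of `ℓ` bits and messages of at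
most `B` bits. All nodes run the same program and local computation is unrestricted. The number
of nodes is known to them: a separate algorithm may be chosen for every number of nodes. -/
structure CongestAlgorithm (ℓ B : ℕ) where
  /-- The internal states of a node. -/
  State : Type
  /-- The initial state, from the node's own identifier, the set of the identifiers of its
  neighbours, and its private coins. -/
  init : NodeId ℓ → Set (NodeId ℓ) → Coins → State
  /-- The message that a node in a given state sends to the neighbour with a given identifier. -/
  send : State → NodeId ℓ → Message B
  /-- The state after a round, from the state before it and the messages received in it, each of
  them paired with the identifier of its sender. -/
  receive : State → Set (NodeId ℓ × Message B) → State
  /-- The list that a node in a given state outputs; its items are sets of nodes, given by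
  their identifiers. -/
  output : State → Set (Finset (NodeId ℓ))

/-- The diamond: the complete graph on four vertices with one edge removed. -/
def diamond : SimpleGraph (Fin 4) := (⊤ : SimpleGraph (Fin 4)).deleteEdges {s(0, 1)}

/-- The vertex set `S` induces a diamond in `G`. -/
def IsInducedDiamond {V : Type*} (G : SimpleGraph V) (S : Finset V) : Prop :=
  Nonempty (G.induce (S : Set V) ≃g diamond)

namespace CongestAlgorithm

variable {ℓ B n : ℕ}

/-- The state of every node after `t` synchronous rounds on the network `G`, whose node `v` has
the identifier `ident v` and the private coins `ω v`. -/
def stateAfter (A : CongestAlgorithm ℓ B) (G : SimpleGraph (Fin n)) (ident : Fin n ↪ NodeId ℓ)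
    (ω : Fin n → Coins) : ℕ → Fin n → A.State
  | 0, v => A.init (ident v) (ident '' G.neighborSet v) (ω v)
  | t + 1, v =>
      A.receive (A.stateAfter G ident ω t v)
        ((fun u => (ident u, A.send (A.stateAfter G ident ω t u) (ident v))) '' G.neighborSet v)

/-- After `T` rounds, every induced diamond is in the output of at least one node, and every
item that some node outputs is an induced diamond. -/
def ListsDiamondsOn (A : CongestAlgorithm ℓ B) (T : ℕ) (G : SimpleGraph (Fin n))
    (ident : Fin n ↪ NodeId ℓ) (ω : Fin n → Coins) : Prop :=
  ⋃ v, A.output (A.stateAfter G ident ω T v) =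
    {D | ∃ S : Finset (Fin n), IsInducedDiamond G S ∧ D = S.map ident}

/-- `A` lists all induced diamonds in `T` rounds, with probability at least `p`, on every
network of `n` nodes, for every assignment of distinct identifiers. The nodes' coins are
independent. As a program may be any function of the coins, the event of success is asked to
contain a measurable event of probability at least `p`. -/
def ListsInducedDiamonds (A : CongestAlgorithm ℓ B) (n T : ℕ) (p : ℝ) : Prop :=
  ∀ (G : SimpleGraph (Fin n)) (ident : Fin n ↪ NodeId ℓ),
    ∃ E : Set (Fin n → Coins), MeasurableSet E ∧
      (∀ ω ∈ E, A.ListsDiamondsOn T G ident ω) ∧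
      p ≤ (Measure.pi fun _ : Fin n => coinLaw).real E

end CongestAlgorithm

/-! A counting argument over the networks `splitNetwork e x`, with `x` an m × m Boolean matrix and m
= ⌊n/10⌋. For any two entries of `x`, the left vertices carrying the true bits give an induced
diamond whose vertex set states both values (`isInducedDiamond_splitQuad`,
`eq_of_isInducedDiamond_splitQuad`). A correct listing therefore covers all m⁴ ordered pairs of
entries by squares, one for each node, of the set of entries its output reveals. Some node thus
reveals at least m²/√n entries, of order n^(3/2).

With identifiers and coins fixed, that output depends only on the node's neighbourhood and the
messages sent to it, which take at most 2^n · 3^(BnT) values. An average over the coins fixes one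
outcome that succeeds on a fraction p of all matrices, so `card_mul_two_pow_le` forces BnT to be of
order n^(3/2). -/

/-- In an induced diamond, only one pair of distinct vertices is not adjacent. -/
theorem IsInducedDiamond.adj_of_not_adj {V : Type*} {G : SimpleGraph V} {S : Finset V}
    (h : IsInducedDiamond G S) {a b c d : V} (ha : a ∈ S) (hb : b ∈ S) (hc : c ∈ S) (hd : d ∈ S)
    (hab : a ≠ b) (hcd : c ≠ d) (hn : ¬ G.Adj a b) (hne : s(c, d) ≠ s(a, b)) : G.Adj c d := by
  obtain ⟨φ⟩ := h
  have key : ∀ p q r s : Fin 4, p ≠ q → r ≠ s → ¬ diamond.Adj p q → ¬ diamond.Adj r s →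
      (r = p ∧ s = q) ∨ (r = q ∧ s = p) := by
    unfold diamond
    simp only [SimpleGraph.deleteEdges_adj, SimpleGraph.top_adj, Set.mem_singleton_iff]
    decide
  by_contra hcd'
  have adj : ∀ u v : (S : Set V), diamond.Adj (φ u) (φ v) ↔ G.Adj u v := fun u v => by
    rw [φ.map_rel_iff]; rfl
  have ne : ∀ u v : (S : Set V), (u : V) ≠ v → φ u ≠ φ v := fun u v huv he =>
    huv (congrArg Subtype.val (φ.injective he))
  have := key (φ ⟨a, ha⟩) (φ ⟨b, hb⟩) (φ ⟨c, hc⟩) (φ ⟨d, hd⟩) (ne _ _ hab) (ne _ _ hcd)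
    (by rw [adj]; exact hn) (by rw [adj]; exact hcd')
  simp only [EmbeddingLike.apply_eq_iff_eq, Subtype.mk.injEq] at this
  exact hne (Sym2.eq_iff.2 this)

theorem isInducedDiamond_of_adj {V : Type*} [DecidableEq V] {G : SimpleGraph V} {a b c d : V}
    (hab : a ≠ b) (hn : ¬ G.Adj a b) (hac : G.Adj a c) (had : G.Adj a d) (hbc : G.Adj b c)
    (hbd : G.Adj b d) (hcd : G.Adj c d) : IsInducedDiamond G {a, b, c, d} := by
  have hS : ∀ k : Fin 4, ![a, b, c, d] k ∈ (({a, b, c, d} : Finset V) : Set V) := by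
    intro k; fin_cases k <;> simp
  let f : Fin 4 → (({a, b, c, d} : Finset V) : Set V) := fun k => ⟨![a, b, c, d] k, hS k⟩
  have hf : Function.Bijective f := by
    constructor
    · intro k l hkl
      have hkl := congrArg Subtype.val hkl
      have := hac.ne; have := had.ne; have := hbc.ne; have := hbd.ne; have := hcd.ne
      fin_cases k <;> fin_cases l <;> simp [f] at hkl ⊢ <;> grind
    · rintro ⟨u, hu⟩
      simp only [Finset.coe_insert, Finset.coe_singleton, Set.mem_insert_iff,
        Set.mem_singleton_iff] at hu
      rcases hu with rfl | rfl | rfl | rfl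
      exacts [⟨0, rfl⟩, ⟨1, rfl⟩, ⟨2, rfl⟩, ⟨3, rfl⟩]
  refine ⟨(RelIso.mk (Equiv.ofBijective f hf) ?_ : diamond ≃g _).symm⟩
  intro k l
  change G.Adj (![a, b, c, d] k) (![a, b, c, d] l) ↔ diamond.Adj k l
  unfold diamond
  simp only [SimpleGraph.deleteEdges_adj, SimpleGraph.top_adj, Set.mem_singleton_iff]
  fin_cases k <;> fin_cases l <;>
    simp [hn, hac, had, hbc, hbd, hcd, hac.symm, had.symm, hbc.symm, hbd.symm, hcd.symm,
      mt G.adj_symm hn]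

/-! ### Hard networks -/

/-- The vertices of the hard networks: a left vertex consists of an index, a pair of bits and the
number of a copy, a right vertex of an index and a bit. -/
abbrev SplitVertex (m : ℕ) : Type := (Fin m × (Bool × Bool) × Bool) ⊕ (Fin m × Bool)

/-- The split graph of a Boolean matrix: the left vertices form a clique, the right vertices are
independent, and a left vertex with bits `α` at row `i` is adjacent to the right vertex with bit
`b` at column `j` when the entry of the matrix at `(i, j)` is the bit of `α` that `b` selects. -/
def splitGraph {m : ℕ} (x : Fin m × Fin m → Bool) : SimpleGraph (SplitVertex m) where
  Adj
    | .inl u, .inl v => u ≠ v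
    | .inl u, .inr w => x (u.1, w.1) = bif w.2 then u.2.1.2 else u.2.1.1
    | .inr w, .inl u => x (u.1, w.1) = bif w.2 then u.2.1.2 else u.2.1.1
    | .inr _, .inr _ => False
  symm := ⟨by rintro (u | u) (v | v) h <;> first | exact h | exact h.symm⟩
  loopless := ⟨by rintro (u | u) h; exacts [h rfl, h]⟩

/-- Two left and two right vertices at the given rows and columns. -/
def splitQuad {m : ℕ} (i i' j j' : Fin m) (α α' : Bool × Bool) : Finset (SplitVertex m) :=
  {.inr (j, false), .inr (j', true), .inl (i, α, false), .inl (i', α', true)}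

/-- The network on `n` nodes that contains the split graph of a Boolean matrix. -/
abbrev splitNetwork {m n : ℕ} (e : SplitVertex m ↪ Fin n) (x : Fin m × Fin m → Bool) :
    SimpleGraph (Fin n) := (splitGraph x).map e

theorem isInducedDiamond_splitQuad {m n : ℕ} (e : SplitVertex m ↪ Fin n)
    (x : Fin m × Fin m → Bool) (i i' j j' : Fin m) :
    IsInducedDiamond (splitNetwork e x)
      ((splitQuad i i' j j' (x (i, j), x (i, j')) (x (i', j), x (i', j'))).map e) := by
  simp only [splitQuad, Finset.map_insert, Finset.map_singleton]
  -- The bits of the right vertices and the copy numbers of the left ones keep the four vertices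
  -- distinct even when `i = i'` or `j = j'`.
  apply isInducedDiamond_of_adj <;> simp [splitNetwork, splitGraph]

theorem eq_of_isInducedDiamond_splitQuad {m n : ℕ} {e : SplitVertex m ↪ Fin n}
    {x : Fin m × Fin m → Bool} {i i' j j' : Fin m} {α α' : Bool × Bool}
    (h : IsInducedDiamond (splitNetwork e x) ((splitQuad i i' j j' α α').map e)) :
    x (i, j) = α.1 ∧ x (i', j') = α'.2 := by
  have key : ∀ u v, u ∈ splitQuad i i' j j' α α' → v ∈ splitQuad i i' j j' α α' → u ≠ v →
      s(u, v) ≠ s(.inr (j, false), .inr (j', true)) → (splitGraph x).Adj u v := by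
    intro u v hu hv huv hne
    rw [← SimpleGraph.map_adj_apply (f := e)]
    refine h.adj_of_not_adj (a := e (.inr (j, false))) (b := e (.inr (j', true)))
      ?_ ?_ ?_ ?_ ?_ ?_ ?_ ?_
    · exact Finset.mem_map_of_mem _ (by simp [splitQuad])
    · exact Finset.mem_map_of_mem _ (by simp [splitQuad])
    · exact Finset.mem_map_of_mem _ hu
    · exact Finset.mem_map_of_mem _ hv
    · simp
    · simpa using huv
    · simp [splitGraph]
    · simpa [Sym2.eq_iff] using hne
  constructor
  · exact key (.inl (i, α, false)) (.inr (j, false)) (by simp [splitQuad]) (by simp [splitQuad])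
      (by simp) (by simp)
  · exact key (.inl (i', α', true)) (.inr (j', true)) (by simp [splitQuad]) (by simp [splitQuad])
      (by simp) (by simp)

/-! ### Counting: codes and what a node learns -/

/-- If every vector in `X` has at least `q` coordinates that are determined by its code, then `X`
is small. -/
theorem card_mul_two_pow_le_of_code {ι κ : Type*} [Fintype ι] [DecidableEq ι] [Fintype κ]
    (X : Finset (ι → Bool)) (f : (ι → Bool) → κ) (q : ℕ)
    (h : ∀ x ∈ X, ∃ C : Finset ι, q ≤ C.card ∧ ∀ y ∈ X, f y = f x → ∀ c ∈ C, y c = x c) :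
    X.card * 2 ^ q ≤ Fintype.card κ * 2 ^ Fintype.card ι := by
  classical
  by_cases hX : X = ∅
  · simp [hX]
  have hq : q ≤ Fintype.card ι := by
    obtain ⟨x, hx⟩ := Finset.nonempty_iff_ne_empty.2 hX
    obtain ⟨C, hC, -⟩ := h x hx
    exact hC.trans (Finset.card_le_univ C)
  have fiber : ∀ k ∈ (Finset.univ : Finset κ),
      (X.filter fun x => f x = k).card ≤ 2 ^ (Fintype.card ι - q) := by
    intro k _
    rcases (X.filter fun x => f x = k).eq_empty_or_nonempty with h0 | ⟨x, hx⟩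
    · simp [h0]
    obtain ⟨hxX, rfl⟩ := Finset.mem_filter.1 hx
    obtain ⟨C, hC, hdet⟩ := h x hxX
    calc (X.filter fun y => f y = f x).card
        -- A fibre lies in a subcube: the coordinates in the set `C` of any one of its members are
        -- constant on it.
        ≤ (Fintype.piFinset fun c => if c ∈ C then {x c} else (Finset.univ : Finset Bool)).card := by
          refine Finset.card_le_card fun y hy => ?_
          obtain ⟨hyX, hyf⟩ := Finset.mem_filter.1 hy
          refine Fintype.mem_piFinset.2 fun c => ?_
          by_cases hc : c ∈ C
          · simp [hc, hdet y hyX hyf c hc]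
          · simp [hc]
      _ = 2 ^ (Fintype.card ι - C.card) := by
          rw [Fintype.card_piFinset, ← Finset.card_compl, ← Finset.prod_const,
            ← Finset.prod_subset (Finset.subset_univ Cᶜ)]
          · refine Finset.prod_congr rfl fun c hc => ?_
            simp [Finset.mem_compl.1 hc]
          · intro c _ hc
            simp [not_not.1 (mt Finset.mem_compl.2 hc)]
      _ ≤ 2 ^ (Fintype.card ι - q) := Nat.pow_le_pow_right two_pos (Nat.sub_le_sub_left hC _)
  have := Finset.card_le_mul_card_image_of_maps_to (s := X) (t := Finset.univ) (f := f)
    (fun _ _ => Finset.mem_univ _) _ fiber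
  calc X.card * 2 ^ q ≤ 2 ^ (Fintype.card ι - q) * Fintype.card κ * 2 ^ q :=
        Nat.mul_le_mul_right _ this
    _ = Fintype.card κ * (2 ^ (Fintype.card ι - q) * 2 ^ q) := by ring
    _ = _ := by rw [← pow_add, Nat.sub_add_cancel hq]

/-- A message as a word of fixed length with blanks. -/
def encodeMessage {B : ℕ} (msg : Message B) : Fin B → Option Bool := fun k => msg.1[(k : ℕ)]?

theorem encodeMessage_injective (B : ℕ) : Function.Injective (encodeMessage (B := B)) := by
  intro a b h
  apply Subtype.ext
  apply List.ext_getElem?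
  intro k
  by_cases hk : k < B
  · exact congrFun h ⟨k, hk⟩
  · rw [List.getElem?_eq_none (a.2.trans (not_lt.1 hk)),
      List.getElem?_eq_none (b.2.trans (not_lt.1 hk))]

namespace CongestAlgorithm

/-- What a node learns of the network in `T` rounds: its neighbours, and the messages that every
node addresses to it. -/
def view {ℓ B n : ℕ} (A : CongestAlgorithm ℓ B) (ident : Fin n ↪ NodeId ℓ) (ω : Fin n → Coins)
    (T : ℕ) (v : Fin n) (G : SimpleGraph (Fin n)) :
    Set (Fin n) × (Fin T → Fin n → Fin B → Option Bool) :=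
  (G.neighborSet v, fun t u => encodeMessage (A.send (A.stateAfter G ident ω t u) (ident v)))

theorem stateAfter_eq_of_view_eq {ℓ B n : ℕ} {A : CongestAlgorithm ℓ B} {ident : Fin n ↪ NodeId ℓ}
    {ω : Fin n → Coins} {T : ℕ} {v : Fin n} {G G' : SimpleGraph (Fin n)}
    (h : A.view ident ω T v G = A.view ident ω T v G') :
    A.stateAfter G ident ω T v = A.stateAfter G' ident ω T v := by
  have hN : G.neighborSet v = G'.neighborSet v := congrArg Prod.fst h
  have hM : ∀ t < T, ∀ u, A.send (A.stateAfter G ident ω t u) (ident v) =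
      A.send (A.stateAfter G' ident ω t u) (ident v) := fun t ht u =>
    encodeMessage_injective B (congrFun (congrFun (congrArg Prod.snd h) ⟨t, ht⟩) u)
  suffices ∀ t ≤ T, A.stateAfter G ident ω t v = A.stateAfter G' ident ω t v from this T le_rfl
  intro t
  induction t with
  | zero => intro _; simp only [stateAfter, hN]
  | succ t ih =>
    intro ht
    simp only [stateAfter, hN, ih (Nat.le_of_succ_le ht), hM t ht]

/-- The entries of the matrix that a list of vertex sets reveals. -/
def revealed {ℓ m n : ℕ} (e : SplitVertex m ↪ Fin n) (ident : Fin n ↪ NodeId ℓ)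
    (O : Set (Finset (NodeId ℓ))) : Set (Fin m × Fin m) :=
  {c | ∃ i i' j j' α α', ((splitQuad i i' j j' α α').map e).map ident ∈ O ∧
    (c = (i, j) ∨ c = (i', j'))}

theorem ListsDiamondsOn.isInducedDiamond {ℓ B n T : ℕ} {A : CongestAlgorithm ℓ B}
    {G : SimpleGraph (Fin n)} {ident : Fin n ↪ NodeId ℓ} {ω : Fin n → Coins}
    (h : A.ListsDiamondsOn T G ident ω) {v : Fin n} {S : Finset (Fin n)}
    (hS : S.map ident ∈ A.output (A.stateAfter G ident ω T v)) : IsInducedDiamond G S := by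
  have : S.map ident ∈ ⋃ v, A.output (A.stateAfter G ident ω T v) := Set.mem_iUnion.2 ⟨v, hS⟩
  rw [h] at this
  obtain ⟨S', hS', heq⟩ := this
  rwa [Finset.map_injective ident heq]

theorem ListsDiamondsOn.eq_of_mem_revealed {ℓ B m n T : ℕ} {A : CongestAlgorithm ℓ B}
    {e : SplitVertex m ↪ Fin n} {x y : Fin m × Fin m → Bool} {ident : Fin n ↪ NodeId ℓ}
    {ω : Fin n → Coins} (hx : A.ListsDiamondsOn T (splitNetwork e x) ident ω)
    (hy : A.ListsDiamondsOn T (splitNetwork e y) ident ω) {v : Fin n}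
    (hv : A.view ident ω T v (splitNetwork e y) = A.view ident ω T v (splitNetwork e x))
    {c : Fin m × Fin m}
    (hc : c ∈ revealed e ident (A.output (A.stateAfter (splitNetwork e x) ident ω T v))) :
    y c = x c := by
  obtain ⟨i, i', j, j', α, α', hO, hc⟩ := hc
  have h1 := eq_of_isInducedDiamond_splitQuad (hx.isInducedDiamond hO)
  rw [← stateAfter_eq_of_view_eq hv] at hO
  have h2 := eq_of_isInducedDiamond_splitQuad (hy.isInducedDiamond hO)
  rcases hc with rfl | rfl
  exacts [h2.1.trans h1.1.symm, h2.2.trans h1.2.symm]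

/-- One diamond reveals two entries to the same node, so pairs of entries are what is covered. This
gains a factor √n over covering single entries. -/
theorem ListsDiamondsOn.exists_card_revealed {ℓ B m n T : ℕ} {A : CongestAlgorithm ℓ B}
    (hn : 0 < n) {e : SplitVertex m ↪ Fin n} {x : Fin m × Fin m → Bool}
    {ident : Fin n ↪ NodeId ℓ} {ω : Fin n → Coins}
    (h : A.ListsDiamondsOn T (splitNetwork e x) ident ω) :
    ∃ v, ∃ C : Finset (Fin m × Fin m), m ^ 4 ≤ n * C.card ^ 2 ∧
      ∀ c ∈ C, c ∈ revealed e ident (A.output (A.stateAfter (splitNetwork e x) ident ω T v)) := by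
  classical
  have : Nonempty (Fin n) := ⟨⟨0, hn⟩⟩
  let C : Fin n → Finset (Fin m × Fin m) := fun v =>
    (revealed e ident (A.output (A.stateAfter (splitNetwork e x) ident ω T v))).toFinset
  have hcover : (Finset.univ : Finset ((Fin m × Fin m) × (Fin m × Fin m))) ⊆
      Finset.univ.biUnion fun v => C v ×ˢ C v := by
    rintro ⟨⟨i, j⟩, ⟨i', j'⟩⟩ -
    have hmem := isInducedDiamond_splitQuad e x i i' j j'
    have : ((splitQuad i i' j j' (x (i, j), x (i, j')) (x (i', j), x (i', j'))).map e).map ident ∈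
        ⋃ v, A.output (A.stateAfter (splitNetwork e x) ident ω T v) := by
      rw [h]; exact ⟨_, hmem, rfl⟩
    obtain ⟨v, hv⟩ := Set.mem_iUnion.1 this
    simp only [Finset.mem_biUnion, Finset.mem_univ, true_and, Finset.mem_product, C,
      Set.mem_toFinset]
    exact ⟨v, ⟨i, i', j, j', _, _, hv, .inl rfl⟩, ⟨i, i', j, j', _, _, hv, .inr rfl⟩⟩
  have hcard : m ^ 4 ≤ ∑ v, (C v).card ^ 2 := by
    calc m ^ 4 = (Finset.univ : Finset ((Fin m × Fin m) × (Fin m × Fin m))).card := by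
          simp only [Finset.card_univ, Fintype.card_prod, Fintype.card_fin]; ring
      _ ≤ _ := Finset.card_le_card hcover
      _ ≤ _ := Finset.card_biUnion_le
      _ = _ := by simp only [Finset.card_product, sq]
  obtain ⟨v, -, hv⟩ := Finset.exists_max_image Finset.univ (fun v => (C v).card ^ 2)
    Finset.univ_nonempty
  refine ⟨v, C v, hcard.trans ?_, fun c hc => Set.mem_toFinset.1 hc⟩
  simpa using Finset.sum_le_card_nsmul Finset.univ _ _ hv

theorem card_mul_two_pow_le {ℓ B m n T q : ℕ} (A : CongestAlgorithm ℓ B) (hn : 0 < n)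
    (e : SplitVertex m ↪ Fin n) (ident : Fin n ↪ NodeId ℓ) (ω : Fin n → Coins)
    (X : Finset (Fin m × Fin m → Bool))
    (hX : ∀ x ∈ X, A.ListsDiamondsOn T (splitNetwork e x) ident ω)
    (hq : ∀ k : ℕ, m ^ 4 ≤ n * k ^ 2 → q ≤ k) :
    X.card * 2 ^ q ≤ n * 2 ^ n * 3 ^ (B * n * T) * 2 ^ (m * m) := by
  classical
  have : Nonempty (Fin n) := ⟨⟨0, hn⟩⟩
  choose! v C hC hrev using fun x hx => (hX x hx).exists_card_revealed hn
  -- The code names the node that reveals many entries, together with its view.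
  have := card_mul_two_pow_le_of_code X
    (fun x => (v x, A.view ident ω T (v x) (splitNetwork e x))) q (fun x hx =>
      ⟨C x, hq _ (hC x hx), fun y hy hxy c hc => by
        obtain ⟨hv, hview⟩ := Prod.mk.inj hxy
        rw [hv] at hview
        exact (hX x hx).eq_of_mem_revealed (hX y hy) hview (hrev x hx c hc)⟩)
  simpa [Fintype.card_prod, ← pow_mul, mul_assoc] using this

end CongestAlgorithm

/-! ### Averaging over the coins and the final bound -/

/-- Some point lies in at least the average number of events. -/
theorem exists_mul_card_le_card_filter_mem {Ω ι : Type*} [MeasurableSpace Ω] (μ : Measure Ω)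
    [IsProbabilityMeasure μ] [Fintype ι] {E : ι → Set Ω} (hE : ∀ x, MeasurableSet (E x)) {p : ℝ}
    (hp : ∀ x, p ≤ μ.real (E x)) :
    ∃ (ω : Ω) (X : Finset ι), (∀ x ∈ X, ω ∈ E x) ∧ p * Fintype.card ι ≤ X.card := by
  classical
  have hint : ∀ x ∈ (Finset.univ : Finset ι),
      Integrable ((E x).indicator (fun _ => (1 : ℝ))) μ := fun x _ =>
    (integrable_const 1).indicator (hE x)
  obtain ⟨ω, hω⟩ := exists_integral_le (integrable_finsetSum _ hint)
  refine ⟨ω, Finset.univ.filter fun x => ω ∈ E x, by simp, ?_⟩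
  rw [integral_finsetSum _ hint] at hω
  calc p * Fintype.card ι = ∑ _x : ι, p := by simp [mul_comm]
    _ ≤ ∑ x, ∫ ω, (E x).indicator (fun _ => (1 : ℝ)) ω ∂μ := by
        refine Finset.sum_le_sum fun x _ => ?_
        rw [integral_indicator_const _ (hE x)]
        simpa using hp x
    _ ≤ _ := hω
    _ = _ := by simp [Set.indicator_apply]

instance : IsProbabilityMeasure coinLaw := by
  unfold coinLaw; infer_instance

namespace CongestAlgorithm

theorem ListsInducedDiamonds.mul_two_pow_le {ℓ B m n T q : ℕ} {A : CongestAlgorithm ℓ B} {p : ℝ}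
    (hA : A.ListsInducedDiamonds n T p) (hn : 0 < n) (hℓ : n ≤ 2 ^ ℓ) (hm : 10 * m ≤ n)
    (hq : ∀ k : ℕ, m ^ 4 ≤ n * k ^ 2 → q ≤ k) :
    p * 2 ^ q ≤ n * 2 ^ n * 3 ^ (B * n * T) := by
  classical
  obtain ⟨e⟩ : Nonempty (SplitVertex m ↪ Fin n) :=
    -- The split graph has 8m + 2m vertices; the remaining nodes stay isolated.
    Function.Embedding.nonempty_of_card_le (by simp; omega)
  obtain ⟨ident⟩ : Nonempty (Fin n ↪ NodeId ℓ) :=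
    Function.Embedding.nonempty_of_card_le (by simpa using hℓ)
  choose E hE hsucc hp using fun x => hA (splitNetwork e x) ident
  obtain ⟨ω, X, hX, hcard⟩ := exists_mul_card_le_card_filter_mem _ hE hp
  have h := A.card_mul_two_pow_le hn e ident ω X (fun x hx => hsucc x ω (hX x hx)) hq
  have h' : (X.card : ℝ) * 2 ^ q ≤ n * 2 ^ n * 3 ^ (B * n * T) * 2 ^ (m * m) := by
    exact_mod_cast h
  have hcard' : p * 2 ^ (m * m) ≤ X.card := by simpa using hcard
  refine le_of_mul_le_mul_right ?_ (show (0 : ℝ) < 2 ^ (m * m) by positivity)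
  calc p * 2 ^ q * 2 ^ (m * m) = p * 2 ^ (m * m) * 2 ^ q := by ring
    _ ≤ X.card * 2 ^ q := by gcongr
    _ ≤ _ := h'

end CongestAlgorithm

theorem theorem5 (β p : ℝ) (hβ : 0 < β) (hp : 0 < p) :
    ∃ c : ℝ, 0 < c ∧ ∃ N : ℕ, ∀ n : ℕ, N ≤ n →
      ∀ ℓ B T : ℕ, n ≤ 2 ^ ℓ → (B : ℝ) ≤ β * Real.log n →
        ∀ A : CongestAlgorithm ℓ B, A.ListsInducedDiamonds n T p →
          c * (Real.sqrt n / Real.log n) ≤ (T : ℝ) := by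
  obtain ⟨K, hK⟩ := pow_unbounded_of_one_lt (1 / p) (one_lt_two (α := ℝ))
  refine ⟨1 / (1600 * β), by positivity, max K (2400 ^ 2), ?_⟩
  intro n hN ℓ B T hℓ hB A hA
  have hKn : K ≤ n := (le_max_left _ _).trans hN
  have hn : 2400 ^ 2 ≤ n := (le_max_right _ _).trans hN
  have hn0 : 0 < n := by omega
  have hnR : (0 : ℝ) < n := by exact_mod_cast hn0
  have hs0 : 0 < Real.sqrt n := Real.sqrt_pos.2 hnR
  have hss : Real.sqrt n * Real.sqrt n = n := Real.mul_self_sqrt hnR.le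
  have hs : 2400 ≤ Real.sqrt n := Real.le_sqrt_of_sq_le (by exact_mod_cast hn)
  set m := n / 10 with hm
  have hmn : (n : ℝ) ≤ 20 * m := by exact_mod_cast (by omega : n ≤ 20 * m)
  set q := ⌈(m : ℝ) ^ 2 / Real.sqrt n⌉₊ with hq
  have hmain := hA.mul_two_pow_le (m := m) (q := q) hn0 hℓ (by omega) (fun k hk => by
    refine Nat.ceil_le.2 ((div_le_iff₀ hs0).2 ?_)
    have hk : (m : ℝ) ^ 4 ≤ n * (k : ℝ) ^ 2 := by exact_mod_cast hk
    refine le_of_sq_le_sq ?_ (by positivity)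
    calc ((m : ℝ) ^ 2) ^ 2 = (m : ℝ) ^ 4 := by ring
      _ ≤ n * (k : ℝ) ^ 2 := hk
      _ = (k * Real.sqrt n) ^ 2 := by rw [mul_pow, Real.sq_sqrt hnR.le, mul_comm])
  -- Each of 1/p, n and the number of neighbourhoods is at most 2^n, and 3 ≤ 2².
  have hexp : q ≤ 3 * n + 2 * (B * n * T) := by
    have h3 : (3 : ℝ) ^ (B * n * T) ≤ 2 ^ (2 * (B * n * T)) := by
      rw [pow_mul (2 : ℝ) 2]; exact pow_le_pow_left₀ (by norm_num) (by norm_num) _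
    have hlt : (n : ℝ) ≤ 2 ^ n := by exact_mod_cast Nat.lt_two_pow_self.le
    have hKp : 1 ≤ 2 ^ n * p := by
      have : (2 : ℝ) ^ K ≤ 2 ^ n := pow_le_pow_right₀ one_le_two hKn
      exact ((div_lt_iff₀ hp).1 (hK.trans_le this)).le
    have : (2 : ℝ) ^ q ≤ 2 ^ (3 * n + 2 * (B * n * T)) := by
      calc (2 : ℝ) ^ q ≤ 2 ^ n * p * 2 ^ q := le_mul_of_one_le_left (by positivity) hKp
        _ = 2 ^ n * (p * 2 ^ q) := by ring
        _ ≤ 2 ^ n * (n * 2 ^ n * 3 ^ (B * n * T)) := by gcongr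
        _ ≤ 2 ^ n * (2 ^ n * 2 ^ n * 2 ^ (2 * (B * n * T))) := by gcongr
        _ = _ := by ring
    exact (pow_le_pow_iff_right₀ one_lt_two).1 this
  have hqR : (m : ℝ) ^ 2 / Real.sqrt n ≤ 3 * n + 2 * (B * n * T) := by
    have : (q : ℝ) ≤ 3 * n + 2 * (B * n * T) := by exact_mod_cast hexp
    exact (Nat.le_ceil _).trans this
  have hlog : 0 < Real.log n := Real.log_pos (by exact_mod_cast (by omega : 1 < n))
  have h1 : Real.sqrt n / 400 ≤ 3 + 2 * (B * T) := by
    have : (n : ℝ) ^ 2 ≤ 400 * (m : ℝ) ^ 2 := by nlinarith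
    have h2 := (div_le_iff₀ hs0).1 hqR
    have h3 : (n : ℝ) ^ 2 ≤ 400 * ((3 + 2 * (B * T)) * n * Real.sqrt n) := by linarith
    have h4 : n * Real.sqrt n * Real.sqrt n ≤
        n * Real.sqrt n * (400 * (3 + 2 * (B * T)) : ℝ) := by
      calc n * Real.sqrt n * Real.sqrt n = (n : ℝ) ^ 2 := by rw [mul_assoc, hss, sq]
        _ ≤ _ := h3
        _ = _ := by ring
    linarith [le_of_mul_le_mul_left h4 (by positivity)]
  have h2 : (B : ℝ) * T ≤ β * Real.log n * T := by gcongr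
  -- Since √n ≥ 2400, the term 3 · 400 in `h1` is at most √n/2; this is where 1600 = 2 · 800 comes
  -- from.
  have h3 : Real.sqrt n ≤ T * (1600 * β * Real.log n) := by linarith
  rw [div_mul_div_comm, one_mul]
  exact (div_le_iff₀ (by positivity)).2 h3
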